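/- Let $\mathbb Z$ act on $A^{\mathbb Z}$ ($A$ a finite set with the discrete topology) by the shift $(g\cdot x)(h)=x(h+g)$, and let $F(2^{\mathbb Z})=\{x\in\{0,1\}^{\mathbb Z} : g\cdot x\neq x \text{ for all } g\neq 0\}$ be the free part, with the subspace topology. For $b\in\mathbb N$, identified with $\{0,\dots,b-1\}$, and finitely many patterns $p_i\colon\{0,\dots,a_i-1\}\to b$ with $a_i\ge 1$ $(1\le i\le k)$, let $Y_{(b;p_1,\dots,p_k)}\subseteq b^{\mathbb Z}$ be the subshift of finite type consisting of all $x\in b^{\mathbb Z}$ in which no $p_i$ occurs, i.e. there is no $c\in\mathbb Z$ with $x(c+j)=p_i(j)$ for all $0\le j<a_i$. Fix a standard computable coding of the tuples $(b;p_1,\dots,p_k)$ by integers $m=\langle b,p_1,\dots,p_k\rangle$, and write $Y_m=Y_{(b;p_1,\dots,p_k)}$. (1) The set of integers $m$ which code a subshift of finite type $Y_m\subseteq b^{\mathbb Z}$ for which there is a continuous equivariant map $F(2^{\mathbb Z})\to Y_m$ is computable. (2) Suppose that all the patterns $p_1,\dots,p_k$ have the same length $\ell\ge 1$, and let $Y=Y_{(b;p_1,\dots,p_k)}$.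 Let $\Lambda(Y)$ be the directed graph with vertex set $b^\ell\setminus\{p_1,\dots,p_k\}$ and an edge from $u$ to $v$ iff $(v(0),\dots,v(\ell-2))=(u(1),\dots,u(\ell-1))$. Its directed components are the equivalence classes of the relation "there are directed paths (possibly of length $0$) from $u$ to $v$ and from $v$ to $u$". A directed cycle $(u_0,\dots,u_n)$, $n\ge 1$, $u_n=u_0$, of length $n$ is primitive if no proper subsegment $(u_i,\dots,u_j)$, $i<j$, is a cycle. Then there is a continuous equivariant map $F(2^{\mathbb Z})\to Y$ if and only if there is a directed component $C$ of $\Lambda(Y)$ such that the greatest common divisor of the lengths of the primitive cycles in $C$ is $1$ (the $\gcd$ of the empty set being $0$). -/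

import Mathlib

namespace SubshiftProblem

/-- The shift action of the integer `g` on the sequence `x`: `(g · x)(h) = x(h + g)`. -/
def shift {A : Type} (g : ℤ) (x : ℤ → A) : ℤ → A := fun h => x (h + g)

/-- `F(2^ℤ)`, the free part of the shift action of `ℤ` on `2^ℤ`, with the subspace topology
(of the product of the discrete topologies). -/
def freePart : Set (ℤ → Fin 2) := {x | ∀ g : ℤ, g ≠ 0 → shift g x ≠ x}

/-- The free part is invariant under the shift. -/
theorem shift_mem_freePart (g : ℤ) {x : ℤ → Fin 2} (hx : x ∈ freePart) :
    shift g x ∈ freePart := by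
  intro k hk h
  apply hx k hk
  funext n
  have := congrFun h (n - g)
  simp only [shift] at this ⊢
  rw [show n - g + k + g = n + k by ring, show n - g + g = n by ring] at this
  exact this

/-- The pattern `p : [0, a) → b`, given as the list of its `a` values, occurs in `x ∈ b^ℤ`. -/
def Occurs {b : ℕ} (p : List (Fin b)) (x : ℤ → Fin b) : Prop :=
  ∃ c : ℤ, ∀ i : Fin p.length, x (c + ((i : ℕ) : ℤ)) = p.get i

/-- The subshift of finite type in `b^ℤ` determined by the list of forbidden patterns `ps`. -/
def sft (b : ℕ) (ps : List (List (Fin b))) : Set (ℤ → Fin b) :=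
  {x | ∀ p ∈ ps, ¬ Occurs p x}

/-- There is a continuous, equivariant map from `F(2^ℤ)` to the set `Y ⊆ b^ℤ`. -/
def HasContinuousEquivariantMap {b : ℕ} (Y : Set (ℤ → Fin b)) : Prop :=
  ∃ f : freePart → Y, Continuous f ∧
    ∀ (g : ℤ) (x : freePart),
      (f ⟨shift g x.1, shift_mem_freePart g x.2⟩ : ℤ → Fin b) = shift g (f x : ℤ → Fin b)

/-- The integer `⟨b, p₁, …, p_k⟩` coding the subshift of finite type determined by `b` and
`p₁, …, p_k`. The coding is the standard computable bijection between
`ℕ × List (List ℕ)` and `ℕ`. -/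
def code (b : ℕ) (ps : List (List (Fin b))) : ℕ :=
  Encodable.encode ((b, ps.map fun p => p.map Fin.val) : ℕ × List (List ℕ))

/-- The integer `m` codes, as `m = ⟨b, p₁, …, p_k⟩` with patterns `p_i : [0, a_i) → b`, `a_i ≥ 1`,
a subshift of finite type admitting a continuous, equivariant map from `F(2^ℤ)`. -/
def SubshiftProblemSolvable (m : ℕ) : Prop :=
  ∃ (b : ℕ) (ps : List (List (Fin b))), (∀ p ∈ ps, p ≠ []) ∧ code b ps = m ∧
    HasContinuousEquivariantMap (sft b ps)

/-- The vertices of the window graph of `(b; ℓ; p₁, …, p_k)`: the words `v ∈ b^ℓ` which are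
not among the forbidden patterns. -/
def Window (b ℓ : ℕ) (ps : List (List (Fin b))) : Type :=
  {v : Fin ℓ → Fin b // List.ofFn v ∉ ps}

/-- The directed edges of the window graph: there is an edge from `u` to `v` iff
`(v(0), …, v(ℓ-2)) = (u(1), …, u(ℓ-1))`. -/
def WindowEdge {b ℓ : ℕ} {ps : List (List (Fin b))} (u v : Window b ℓ ps) : Prop :=
  ∀ (i : ℕ) (h : i + 1 < ℓ), v.1 ⟨i, Nat.lt_of_succ_lt h⟩ = u.1 ⟨i + 1, h⟩

/-- The equivalence relation on the vertices of a directed graph: there are directed paths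
(possibly of length zero) in both directions. -/
def mutuallyReachable {V : Type} (E : V → V → Prop) : Setoid V where
  r u v := Relation.ReflTransGen E u v ∧ Relation.ReflTransGen E v u
  iseqv :=
    { refl := fun _ => ⟨.refl, .refl⟩
      symm := fun h => ⟨h.2, h.1⟩
      trans := fun h k => ⟨h.1.trans k.1, k.2.trans h.2⟩ }

/-- `C` is a directed component of the directed graph with edge relation `E`. -/
def IsDirectedComponent {V : Type} (E : V → V → Prop) (C : Set V) : Prop :=
  C ∈ (mutuallyReachable E).classes

/-- `(u 0, u 1, …, u n)` is a directed cycle of length `n`, that is `n ≥ 1`, `u n = u 0`, and there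
is an edge from each `u i` to `u (i + 1)`. -/
structure IsDirectedCycle {V : Type} (E : V → V → Prop) (n : ℕ) (u : Fin (n + 1) → V) : Prop where
  pos : 0 < n
  closed : u 0 = u (Fin.last n)
  edge : ∀ i : Fin n, E (u i.castSucc) (u i.succ)

/-- A directed cycle `(u 0, …, u n)` is primitive if no proper subsegment
`(u i, u (i + 1), …, u j)`, `i < j`, is a cycle. -/
structure IsPrimitiveCycle {V : Type} (E : V → V → Prop) (n : ℕ) (u : Fin (n + 1) → V) : Prop
    extends IsDirectedCycle E n u where
  primitive : ∀ i j : Fin (n + 1), i < j → u i = u j → i = 0 ∧ j = Fin.last n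

/-- The set of lengths of the primitive directed cycles with all vertices in `C`. -/
def primitiveCycleLengths {V : Type} (E : V → V → Prop) (C : Set V) : Set ℕ :=
  {n | ∃ u : Fin (n + 1) → V, IsPrimitiveCycle E n u ∧ ∀ i, u i ∈ C}

end SubshiftProblem

/-! Both statements reduce to one criterion: a continuous equivariant map into a subshift of finite
type exists iff its overlap graph has a vertex carrying closed walks of some lengths `n` and `n + 1`
with `n > 0` (`hasContinuousEquivariantMap_iff`). Necessity: by continuity, the image window at the
jump of a step sequence depends only on a finite block around it. Planting copies of that block at
distances `2R + 1` and `2R + 2` in one free point forces the same vertex to recur at both distances.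
Sufficiency: closed walks of lengths `n` and `n + 1` combine to closed walks of every length at
least `n ^ 2`. The free part has clopen marker sets with gaps at least that large and bounded, so
each gap can be filled by a closed walk of exactly its length. For (2), lengths of closed walks at a
vertex form a numerical semigroup, whose gcd equals the gcd of primitive cycle lengths in the
component. It is `1` iff two consecutive lengths occur. For (1), pigeonhole on the reachability
relations bounds `n` computably. The bounded search over words, coded as base `b` numerals, is
primitive recursive. -/

namespace SubshiftProblem

/-! ### Closed walks and gcds of cycle lengths in directed graphs. -/

section Walks

variable {V : Type} {E : V → V → Prop}

/-- There is a directed walk of length `n` from `u` to `v`. -/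
def HasWalk (E : V → V → Prop) : ℕ → V → V → Prop
  | 0 => fun u v => u = v
  | n + 1 => fun u v => ∃ w, E u w ∧ HasWalk E n w v

theorem hasWalk_add {m n : ℕ} {u v : V} :
    HasWalk E (m + n) u v ↔ ∃ w, HasWalk E m u w ∧ HasWalk E n w v := by
  induction m generalizing u with
  | zero => simp [HasWalk]
  | succ m ih =>
    rw [Nat.succ_add]
    simp only [HasWalk, ih]
    grind

theorem HasWalk.append {m n : ℕ} {u v w : V} (h : HasWalk E m u v) (k : HasWalk E n v w) :
    HasWalk E (m + n) u w :=
  hasWalk_add.2 ⟨v, h, k⟩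

theorem HasWalk.mul {m : ℕ} {v : V} (h : HasWalk E m v v) (k : ℕ) : HasWalk E (k * m) v v := by
  induction k with
  | zero => simp [HasWalk]
  | succ k ih => rw [Nat.succ_mul]; exact ih.append h

theorem hasWalk_of_forall_edge {w : ℕ → V} {n : ℕ} (h : ∀ i < n, E (w i) (w (i + 1))) {i j : ℕ}
    (hij : i ≤ j) (hj : j ≤ n) : HasWalk E (j - i) (w i) (w j) := by
  induction j, hij using Nat.le_induction with
  | base => simp [HasWalk]
  | succ j hij ih =>
    rw [Nat.sub_add_comm hij]
    exact (ih (by omega)).append ⟨_, h j (by omega), rfl⟩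

theorem HasWalk.exists_path {n : ℕ} {u v : V} (h : HasWalk E n u v) :
    ∃ w : ℕ → V, w 0 = u ∧ w n = v ∧ ∀ i < n, E (w i) (w (i + 1)) := by
  induction n generalizing u with
  | zero => exact ⟨fun _ => u, rfl, h, by simp⟩
  | succ n ih =>
    obtain ⟨t, ht, h⟩ := h
    obtain ⟨w, h0, hn, hw⟩ := ih h
    refine ⟨fun i => Nat.casesOn i u w, rfl, hn, fun i hi => ?_⟩
    cases i with
    | zero => simpa [h0] using ht
    | succ i => exact hw i (by omega)

theorem HasWalk.reflTransGen {n : ℕ} {u v : V} (h : HasWalk E n u v) :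
    Relation.ReflTransGen E u v := by
  induction n generalizing u with
  | zero => exact h ▸ .refl
  | succ n ih =>
    obtain ⟨t, ht, h⟩ := h
    exact .head ht (ih h)

theorem exists_hasWalk_of_reflTransGen {u v : V} (h : Relation.ReflTransGen E u v) :
    ∃ n, HasWalk E n u v := by
  induction h with
  | refl => exact ⟨0, rfl⟩
  | tail _ e ih =>
    obtain ⟨n, h⟩ := ih
    exact ⟨n + 1, h.append ⟨_, e, rfl⟩⟩

/-- The length of every closed walk in a component is a multiple of the greatest common divisor
of the lengths of the primitive cycles in the component. -/
theorem setGcd_primitiveCycleLengths_dvd {C : Set V} (hC : IsDirectedComponent E C) {n : ℕ} {v : V}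
    (hv : v ∈ C) (h : HasWalk E n v v) : Nat.setGcd (primitiveCycleLengths E C) ∣ n := by
  induction n using Nat.strong_induction_on generalizing v with
  | _ n ih =>
    obtain rfl | hn := Nat.eq_zero_or_pos n
    · exact dvd_zero _
    obtain ⟨w, h0, hwn, hw⟩ := h.exists_path
    have hmem : ∀ i ≤ n, w i ∈ C := by
      intro i hi
      obtain ⟨x, rfl⟩ := hC
      have h1 := (hasWalk_of_forall_edge hw (Nat.zero_le i) hi).reflTransGen
      have h2 := (hasWalk_of_forall_edge hw hi le_rfl).reflTransGen
      rw [h0] at h1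
      rw [hwn] at h2
      exact (mutuallyReachable E).trans ⟨h2, h1⟩ hv
    by_cases hp : ∀ i j : Fin (n + 1), i < j → w i = w j → i = 0 ∧ j = Fin.last n
    · refine Nat.setGcd_dvd_of_mem ⟨fun i => w i, ⟨⟨hn, ?_, fun i => ?_⟩, hp⟩, fun i => ?_⟩
      · simp [h0, hwn]
      · simpa using hw i i.2
      · exact hmem i (Nat.lt_succ_iff.1 i.2)
    -- A repeated vertex splits the closed walk into an inner loop and the outer walk that skips it.
    -- Both are strictly shorter, so the induction applies to each.
    · push Not at hp
      obtain ⟨i, j, hij, hwij, hne⟩ := hp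
      have hj : (j : ℕ) ≤ n := Nat.lt_succ_iff.1 j.2
      have hij' : (i : ℕ) < j := hij
      have hlt : (j : ℕ) - i < n := by
        by_contra hge
        exact hne (Fin.ext (by rw [Fin.val_zero]; omega)) (Fin.ext (by rw [Fin.val_last]; omega))
      have hin : HasWalk E (j - i : ℕ) (w i) (w i) := by
        have := hasWalk_of_forall_edge hw hij'.le hj
        rwa [← hwij] at this
      have hout : HasWalk E (i + (n - j) : ℕ) v v := by
        have h1 := hasWalk_of_forall_edge hw (Nat.zero_le i) (by omega)
        have h2 := hasWalk_of_forall_edge hw hj le_rfl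
        rw [h0, Nat.sub_zero] at h1
        rw [hwn, ← hwij] at h2
        exact h1.append h2
      have := Nat.dvd_add (ih _ hlt (hmem i (by omega)) hin) (ih _ (by omega) hv hout)
      rwa [show (j - i : ℕ) + (i + (n - j)) = n by omega] at this

/-- A directed graph has closed walks of two consecutive positive lengths at some vertex iff it
has a component whose primitive cycles have coprime lengths. -/
theorem exists_consecutive_closed_walks_iff :
    (∃ v n, 0 < n ∧ HasWalk E n v v ∧ HasWalk E (n + 1) v v) ↔
      ∃ C, IsDirectedComponent E C ∧ Nat.setGcd (primitiveCycleLengths E C) = 1 := by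
  constructor
  · rintro ⟨v, n, -, h, h'⟩
    refine ⟨{u | mutuallyReachable E u v}, ⟨v, rfl⟩, Nat.dvd_one.1 ?_⟩
    have hv : v ∈ {u | mutuallyReachable E u v} := (mutuallyReachable E).refl v
    have hC : IsDirectedComponent E {u | mutuallyReachable E u v} := ⟨v, rfl⟩
    exact (Nat.dvd_add_right (setGcd_primitiveCycleLengths_dvd hC hv h)).1
      (setGcd_primitiveCycleLengths_dvd hC hv h')
  · rintro ⟨C, ⟨v, rfl⟩, h⟩
    let T : AddSubmonoid ℕ :=
      { carrier := {n | HasWalk E n v v}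
        zero_mem' := rfl
        add_mem' := fun h k => h.append k }
    have hT : Nat.setGcd (T : Set ℕ) = 1 := by
      rw [← Nat.dvd_one, ← h, Nat.dvd_setGcd_iff]
      rintro n ⟨u, hu, hmem⟩
      obtain ⟨a, ha⟩ := exists_hasWalk_of_reflTransGen (hmem 0).1
      obtain ⟨c, hc⟩ := exists_hasWalk_of_reflTransGen (hmem 0).2
      have hcyc : HasWalk E n (u 0) (u 0) := by
        have := hasWalk_of_forall_edge (E := E) (n := n)
          (w := fun i => if h : i < n + 1 then u ⟨i, h⟩ else u 0) (fun i hi => by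
            simpa [show i < n + 1 by omega, hi] using hu.edge ⟨i, hi⟩) (Nat.zero_le n) le_rfl
        have hl : u ⟨n, by omega⟩ = u 0 := hu.closed.symm
        simpa [hl] using this
      -- The detour from `v` to the cycle and back is closed at `v` with or without one turn around
      -- the cycle, so the gcd divides the difference `n`.
      have h1 : c + a ∈ T := hc.append ha
      have h2 : c + (n + a) ∈ T := hc.append (hcyc.append ha)
      have := (Nat.dvd_add_right (Nat.setGcd_dvd_of_mem h1)).1
        (show Nat.setGcd (T : Set ℕ) ∣ c + a + n by
          rw [show c + a + n = c + (n + a) by omega]; exact Nat.setGcd_dvd_of_mem h2)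
      exact this
    obtain ⟨n, hn⟩ := Nat.exists_mem_closure_of_ge (T : Set ℕ)
    rw [hT, AddSubmonoid.closure_eq] at hn
    exact ⟨v, n + 1, by omega, hn (n + 1) (by omega) (one_dvd _),
      hn (n + 1 + 1) (by omega) (one_dvd _)⟩

/-- Closed walks of two consecutive lengths can be found among those of bounded length. -/
theorem exists_le_consecutive_closed_walks [Finite V] {v : V} {n : ℕ} (hn : 0 < n)
    (h : HasWalk E n v v) (h' : HasWalk E (n + 1) v v) :
    ∃ m, 0 < m ∧ m ≤ Nat.card (V → V → Prop) ∧ HasWalk E m v v ∧ HasWalk E (m + 1) v v := by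
  induction n using Nat.strong_induction_on with
  | _ n ih =>
    by_cases hle : n ≤ Nat.card (V → V → Prop)
    · exact ⟨n, hn, hle, h, h'⟩
    -- Pigeonhole on whole relations, not just on visited vertices: equality lets both walks, of
    -- lengths `n` and `n + 1`, be shortened by the same amount `j - i`. The offset `+ 1` keeps the
    -- new length positive.
    · have : ∃ i j : Fin n, i < j ∧ HasWalk E (i + 1) = HasWalk E (j + 1) := by
        by_contra hne
        push Not at hne
        have hinj : Function.Injective fun i : Fin n => HasWalk E (i + 1 : ℕ) := by
          intro i j hij
          rcases lt_trichotomy i j with hlt | heq | hlt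
          · exact (hne i j hlt hij).elim
          · exact heq
          · exact (hne j i hlt hij.symm).elim
        have := Nat.card_le_card_of_injective _ hinj
        rw [Nat.card_fin] at this
        exact hle this
      obtain ⟨i, j, hij, heq⟩ := this
      have hij' : (i : ℕ) < j := hij
      have key : ∀ k, HasWalk E (j + 1 + k) v v → HasWalk E (i + 1 + k) v v := by
        intro k hk
        rw [hasWalk_add] at hk ⊢
        rwa [heq]
      have hj := j.2
      refine ih (i + 1 + (n - (j + 1))) (by omega) (by omega) (key _ ?_) (key (n - (j + 1) + 1) ?_)
      · rwa [show (j : ℕ) + 1 + (n - (j + 1)) = n by omega]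
      · rwa [show (j : ℕ) + 1 + (n - (j + 1) + 1) = n + 1 by omega]

/-- Closed walks of lengths `n` and `n + 1` combine to closed walks of all large lengths. -/
theorem hasWalk_of_mul_self_le {v : V} {n m : ℕ} (hn : 0 < n)
    (h : HasWalk E n v v) (h' : HasWalk E (n + 1) v v) (hm : n * n ≤ m) : HasWalk E m v v := by
  have hq : n ≤ m / n := (Nat.le_div_iff_mul_le hn).2 hm
  have hr : m % n < n := Nat.mod_lt _ hn
  have hdm := Nat.div_add_mod m n
  obtain ⟨d, hd⟩ := Nat.exists_eq_add_of_le (hr.le.trans hq)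
  have := (h.mul d).append (h'.mul (m % n))
  -- With `m = q n + r` and `r < n ≤ q`, this is `m = (q - r) n + r (n + 1)`.
  have e : d * n + m % n * (n + 1) = m := by
    conv_rhs => rw [← hdm, hd]
    ring
  rwa [e] at this

end Walks

/-! ### Clopen marker sets in the free part. -/

section Markers

theorem shift_shift {A : Type} (g h : ℤ) (x : ℤ → A) : shift g (shift h x) = shift (g + h) x := by
  funext n
  simp only [shift]
  ring_nf

theorem shift_zero {A : Type} (x : ℤ → A) : shift 0 x = x := by
  funext n
  simp [shift]

theorem continuous_shift {A : Type} [TopologicalSpace A] (g : ℤ) :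
    Continuous (shift g : (ℤ → A) → ℤ → A) :=
  continuous_pi fun n => continuous_apply (n + g)

/-- The shift action on the free part. -/
def freeShift (g : ℤ) (x : freePart) : freePart := ⟨shift g x.1, shift_mem_freePart g x.2⟩

theorem freeShift_freeShift (g h : ℤ) (x : freePart) :
    freeShift g (freeShift h x) = freeShift (g + h) x :=
  Subtype.ext (shift_shift g h x.1)

theorem freeShift_zero (x : freePart) : freeShift 0 x = x :=
  Subtype.ext (shift_zero x.1)

theorem continuous_freeShift (g : ℤ) : Continuous (freeShift g) :=
  ((continuous_shift g).comp continuous_subtype_val).subtype_mk _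

/-- Every point of the free part has a clopen neighbourhood disjoint from its translates by
the nonzero integers of absolute value less than `N`. -/
theorem exists_isClopen_disjoint_translates (N : ℕ) (x : freePart) :
    ∃ U : Set freePart, IsClopen U ∧ x ∈ U ∧
      ∀ g : ℤ, g ≠ 0 → |g| < N → ∀ y ∈ U, freeShift g y ∉ U := by
  have h : ∀ g : ℤ, ∃ n, g ≠ 0 → x.1 (n + g) ≠ x.1 n := by
    intro g
    by_cases hg : g = 0
    · exact ⟨0, fun h => (h hg).elim⟩
    · obtain ⟨n, hn⟩ := Function.ne_iff.1 (x.2 g hg)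
      exact ⟨n, fun _ => hn⟩
  choose c hc using h
  have hcl : ∀ n, IsClopen {y : freePart | y.1 n = x.1 n} := fun n =>
    (isClopen_discrete {x.1 n}).preimage ((continuous_apply n).comp continuous_subtype_val)
  -- Here `c g` is a coordinate where `x` differs from its translate by `g`. Fixing the values at `c
  -- g` and `c g + g` rules out a return under `g`.
  refine ⟨⋂ g ∈ Finset.Ioo (-N : ℤ) N,
    {y | y.1 (c g) = x.1 (c g)} ∩ {y | y.1 (c g + g) = x.1 (c g + g)},
    isClopen_biInter_finset fun g _ => (hcl _).inter (hcl _), by simp, ?_⟩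
  intro g hg hgN y hy hy'
  have hmem : g ∈ Finset.Ioo (-N : ℤ) N := Finset.mem_Ioo.2 (abs_lt.1 hgN)
  have h1 : y.1 (c g + g) = x.1 (c g + g) := (Set.mem_iInter₂.1 hy g hmem).2
  have h2 : y.1 (c g + g) = x.1 (c g) := (Set.mem_iInter₂.1 hy' g hmem).1
  exact hc g hg (h1.symm.trans h2)

open Classical in
/-- The index of the first member of a clopen cover that contains a point is continuous. -/
theorem continuous_find {X : Type*} [TopologicalSpace X] {U : ℕ → Set X}
    (hU : ∀ n, IsClopen (U n)) (h : ∀ x, ∃ n, x ∈ U n) : Continuous fun x => Nat.find (h x) := by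
  refine continuous_discrete_rng.2 fun n => ?_
  have : (fun x => Nat.find (h x)) ⁻¹' {n} = U n ∩ ⋂ i ∈ Finset.range n, (U i)ᶜ := by
    ext x
    simp [Nat.find_eq_iff]
  rw [this]
  exact ((hU _).inter (isClopen_biInter_finset fun i _ => (hU _).compl)).isOpen

/-- There is a continuous colouring of the free part by natural numbers in which points of an
orbit at distance less than `N` have different colours. -/
theorem exists_continuous_coloring (N : ℕ) :
    ∃ c : freePart → ℕ, Continuous c ∧
      ∀ (x : freePart) (g : ℤ), g ≠ 0 → |g| < N → c (freeShift g x) ≠ c x := by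
  classical
  choose U hU hxU hdis using exists_isClopen_disjoint_translates N
  obtain ⟨s, hs, hcov⟩ := TopologicalSpace.countable_cover_nhds
    fun x => (hU x).isOpen.mem_nhds (hxU x)
  obtain he | ⟨⟨x₀⟩⟩ := isEmpty_or_nonempty freePart
  · exact ⟨fun x => he.elim x, continuous_of_const fun x => he.elim x, fun x => he.elim x⟩
  · have hne : s.Nonempty := by
      have : x₀ ∈ ⋃ x ∈ s, U x := hcov ▸ Set.mem_univ _
      obtain ⟨x, hx, -⟩ := Set.mem_iUnion₂.1 this
      exact ⟨x, hx⟩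
    obtain ⟨e, rfl⟩ := hs.exists_eq_range hne
    have hex : ∀ x, ∃ i, x ∈ U (e i) := by
      intro x
      have : x ∈ ⋃ y ∈ Set.range e, U y := hcov ▸ Set.mem_univ _
      simpa using this
    refine ⟨fun x => Nat.find (hex x), ?_, ?_⟩
    · exact continuous_find (fun n => hU (e n)) hex
    · intro x g hg hgN heq
      have h1 := Nat.find_spec (hex x)
      have h2 := Nat.find_spec (hex (freeShift g x))
      simp only at heq
      rw [heq] at h2
      exact hdis _ g hg hgN x h1 h2

/-- The greedy marker set of a colouring: a point is a marker if no point of smaller colour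
at distance less than `N` is one. -/
def IsGreedyMarker (N : ℕ) (c : freePart → ℕ) (x : freePart) : Prop :=
  ∀ g ∈ Finset.Ioo (-N : ℤ) N, ∀ _ : c (freeShift g x) < c x, ¬ IsGreedyMarker N c (freeShift g x)
termination_by c x

/-- Whether a point of colour `n` is a marker depends on finitely many translates of smaller colour,
so each colour layer is clopen by induction. The infinite union of layers is only open a priori; the
complement is open by the same layering. -/
theorem isClopen_isGreedyMarker (N : ℕ) {c : freePart → ℕ} (hc : Continuous c) :
    IsClopen {x | IsGreedyMarker N c x} := by
  have hlt : ∀ n, IsClopen {x | c x < n ∧ IsGreedyMarker N c x} := by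
    intro n
    induction n with
    | zero => simpa using isClopen_empty
    | succ n ih =>
      have : {x | c x < n + 1 ∧ IsGreedyMarker N c x} = {x | c x < n ∧ IsGreedyMarker N c x} ∪
          (c ⁻¹' {n} ∩ ⋂ g ∈ Finset.Ioo (-N : ℤ) N,
            (freeShift g ⁻¹' {x | c x < n ∧ IsGreedyMarker N c x})ᶜ) := by
        ext x
        rcases lt_trichotomy (c x) n with h | h | h
        · simp [h, h.ne, h.le]
        · rw [Set.mem_ofPred_eq, IsGreedyMarker]
          simp [h]
        · simp [h.ne', h.not_gt, h.not_ge]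
      rw [this]
      exact ih.union (((isClopen_discrete {n}).preimage hc).inter
        (isClopen_biInter_finset fun g _ => (ih.preimage (continuous_freeShift g)).compl))
  have hloc : ∀ n, IsClopen {x | c x = n ∧ IsGreedyMarker N c x} := by
    intro n
    have : {x | c x = n ∧ IsGreedyMarker N c x} =
        c ⁻¹' {n} ∩ {x | c x < n + 1 ∧ IsGreedyMarker N c x} := by
      ext x
      simp only [Set.mem_ofPred_eq, Set.mem_inter_iff, Set.mem_preimage, Set.mem_singleton_iff]
      grind
    rw [this]
    exact ((isClopen_discrete {n}).preimage hc).inter (hlt _)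
  constructor
  · rw [← isOpen_compl_iff]
    have : {x | IsGreedyMarker N c x}ᶜ =
        ⋃ n, c ⁻¹' {n} ∩ {x | c x = n ∧ IsGreedyMarker N c x}ᶜ := by
      ext x
      simp
    rw [this]
    exact isOpen_iUnion fun n =>
      (((isClopen_discrete {n}).preimage hc).inter (hloc n).compl).isOpen
  · have : {x | IsGreedyMarker N c x} = ⋃ n, {x | c x = n ∧ IsGreedyMarker N c x} := by
      ext x
      simp
    rw [this]
    exact isOpen_iUnion fun n => (hloc n).isOpen

/-- The free part has clopen marker sets whose gaps are at least `N` and bounded. -/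
theorem exists_clopen_markers (N : ℕ) (hN : 0 < N) :
    ∃ M : Set freePart, IsClopen M ∧
      (∀ x ∈ M, ∀ g : ℤ, 0 < g → freeShift g x ∈ M → (N : ℤ) ≤ g) ∧
      ∀ x, ∃ g : ℤ, |g| < N ∧ freeShift g x ∈ M := by
  obtain ⟨c, hc, hcol⟩ := exists_continuous_coloring N
  refine ⟨{x | IsGreedyMarker N c x}, isClopen_isGreedyMarker N hc, ?_, ?_⟩
  · intro x hx g hg hgx
    by_contra! hlt
    have hg' : |g| < N := by rwa [abs_of_pos hg]
    have hne := hcol x g hg.ne' hg'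
    rw [Set.mem_ofPred_eq] at hx hgx
    rcases hne.lt_or_gt with h | h
    · rw [IsGreedyMarker] at hx
      exact hx g (Finset.mem_Ioo.2 (abs_lt.1 hg')) h hgx
    · rw [IsGreedyMarker] at hgx
      have e : freeShift (-g) (freeShift g x) = x := by
        rw [freeShift_freeShift, neg_add_cancel, freeShift_zero]
      have := hgx (-g) (Finset.mem_Ioo.2 (abs_lt.1 (by rwa [abs_neg])))
      rw [e] at this
      exact this h hx
  · intro x
    by_cases hx : IsGreedyMarker N c x
    · exact ⟨0, by simpa using hN, by rwa [freeShift_zero]⟩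
    · rw [IsGreedyMarker] at hx
      push Not at hx
      obtain ⟨g, hg, -, hgx⟩ := hx
      exact ⟨g, abs_lt.2 (Finset.mem_Ioo.1 hg), hgx⟩

end Markers

/-! ### Equivariant maps and consecutive closed walks. -/

section Characterization

/-- The word of length `L` at position `c` of a sequence. -/
def window {A : Type} (L : ℕ) (x : ℤ → A) (c : ℤ) : Fin L → A := fun i => x (c + ((i : ℕ) : ℤ))

/-- The overlap graph on the words of length `L` satisfying `P`. -/
def WordEdge {A : Type} {L : ℕ} {P : (Fin L → A) → Prop} (u v : {v : Fin L → A // P v}) : Prop :=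
  ∀ (i : ℕ) (h : i + 1 < L), v.1 ⟨i, Nat.lt_of_succ_lt h⟩ = u.1 ⟨i + 1, h⟩

/-- The characteristic function of the nonnegative integers. -/
def step (n : ℤ) : Fin 2 := if n < 0 then 0 else 1

/-- A period would carry a position in the region of ones to one in the region of zeros, or
conversely, after enough multiples. -/
theorem mem_freePart_of_eventually {x : ℤ → Fin 2} (K : ℤ) (h0 : ∀ n < 0, x n = 0)
    (h1 : ∀ n, K ≤ n → x n = 1) : x ∈ freePart := by
  intro g hg h
  have hk : ∀ (k : ℕ) (n : ℤ), x (n + k * g) = x n := by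
    intro k
    induction k with
    | zero => simp
    | succ k ih =>
      intro n
      have := congrFun h (n + k * g)
      rw [shift, ih] at this
      rw [← this]
      push_cast
      ring_nf
  have hlt : ∀ m : ℤ, m < 0 → ∀ n : ℤ, K ≤ n → x m ≠ x n := by
    intro m hm n hn
    rw [h0 m hm, h1 n hn]
    decide
  rcases lt_or_gt_of_ne hg with hg | hg
  · have := hk (K.natAbs + 1) K
    refine hlt _ ?_ K le_rfl this
    push_cast
    have := le_abs_self K
    nlinarith [abs_nonneg K]
  · have := hk (K.natAbs + 1) (-1)
    refine hlt _ (by norm_num) _ ?_ this.symm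
    push_cast
    have := le_abs_self K
    nlinarith [abs_nonneg K]

theorem step_mem_freePart : step ∈ freePart :=
  mem_freePart_of_eventually 0 (fun n hn => by simp [step, hn]) fun n hn => by
    simp [step, hn.not_gt]

/-- A neighbourhood of `x` contains all points that agree with `x` on a large interval. -/
theorem exists_agree_subset {O : Set freePart} (hO : IsOpen O) {x : freePart} (hx : x ∈ O) :
    ∃ R : ℕ, ∀ y : freePart, (∀ n : ℤ, |n| ≤ R → y.1 n = x.1 n) → y ∈ O := by
  obtain ⟨O', hO', rfl⟩ := isOpen_induced_iff.1 hO
  obtain ⟨I, u, hu, hI⟩ := isOpen_pi_iff.1 hO' x.1 hx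
  refine ⟨I.sup Int.natAbs, fun y hy => hI fun n hn => ?_⟩
  rw [hy n]
  · exact (hu n hn).2
  · have := Finset.le_sup (f := Int.natAbs) hn
    rw [Int.abs_eq_natAbs]
    exact_mod_cast this

/-- Copies of the radius `R` block around the jump of `step` force copies of the same image window;
the windows of the image in between form walks. -/
theorem exists_closed_walks_of_map {b L : ℕ} {P : (Fin L → Fin b) → Prop} {Y : Set (ℤ → Fin b)}
    (hY : ∀ x ∈ Y, ∀ c, P (window L x c)) (h : HasContinuousEquivariantMap Y) :
    ∃ (v : {v // P v}) (n : ℕ), 0 < n ∧ HasWalk WordEdge n v v ∧ HasWalk WordEdge (n + 1) v v := by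
  obtain ⟨f, hf, hequiv⟩ := h
  let x : freePart := ⟨step, step_mem_freePart⟩
  have hO : IsOpen {y : freePart | ∀ i : Fin L, (f y).1 (i : ℕ) = (f x).1 (i : ℕ)} := by
    rw [Set.ofPred_forall]
    refine isOpen_iInter_of_finite fun i => ?_
    exact (isOpen_discrete {(f x).1 (i : ℕ)}).preimage
      ((continuous_apply _).comp (continuous_subtype_val.comp hf))
  obtain ⟨R, hR⟩ := exists_agree_subset hO (x := x) fun _ => rfl
  -- Blocks of radius `R` are centred at `0`, `2R + 1` and `4R + 3`. The first two are adjacent and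
  -- the last two leave one spare cell, which makes the distances consecutive.
  let y' : ℤ → Fin 2 := fun n =>
    if n ≤ R then step n else if n ≤ 3 * R + 1 then step (n - (2 * R + 1)) else
      step (n - (4 * R + 3))
  have hy' : y' ∈ freePart := by
    refine mem_freePart_of_eventually (4 * R + 3) (fun n hn => ?_) fun n hn => ?_
    · simp only [y', step]
      grind
    · simp only [y', step]
      grind
  let y : freePart := ⟨y', hy'⟩
  have hmatch : ∀ c : ℕ, (∀ n : ℤ, |n| ≤ R → y' (n + c) = step n) →
      window L (f y).1 c = window L (f x).1 0 := by
    intro c hc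
    funext i
    have h1 := hR (freeShift c y) hc i
    have h2 := congrFun (hequiv c y) (i : ℕ)
    simp only [window, zero_add]
    rw [← h1]
    refine Eq.trans ?_ h2.symm
    rw [shift, add_comm]
  let w : ℕ → {v // P v} := fun c => ⟨window L (f y).1 c, hY _ (f y).2 c⟩
  have hw : ∀ i, WordEdge (w i) (w (i + 1)) := by
    intro i j hj
    simp only [w, window]
    push_cast
    ring_nf
  have e0 : w 0 = ⟨window L (f x).1 0, hY _ (f x).2 0⟩ := Subtype.ext <| hmatch 0 <| by
    intro n hn
    rw [abs_le] at hn
    simp only [y', step]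
    grind
  have e1 : w (2 * R + 1) = ⟨window L (f x).1 0, hY _ (f x).2 0⟩ := Subtype.ext <| hmatch _ <| by
    intro n hn
    rw [abs_le] at hn
    simp only [y', step]
    push_cast
    grind
  have e2 : w (4 * R + 3) = ⟨window L (f x).1 0, hY _ (f x).2 0⟩ := Subtype.ext <| hmatch _ <| by
    intro n hn
    rw [abs_le] at hn
    simp only [y', step]
    push_cast
    grind
  refine ⟨⟨window L (f x).1 0, hY _ (f x).2 0⟩, 2 * R + 1, by omega, ?_, ?_⟩
  · have := hasWalk_of_forall_edge (n := 4 * R + 3) (fun i _ => hw i) (Nat.zero_le (2 * R + 1))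
      (by omega)
    rwa [e0, e1] at this
  · have := hasWalk_of_forall_edge (n := 4 * R + 3) (fun i _ => hw i)
      (show 2 * R + 1 ≤ 4 * R + 3 by omega) le_rfl
    rwa [e1, e2, show 4 * R + 3 - (2 * R + 1) = 2 * R + 1 + 1 by omega] at this

/-- If a directed graph has closed walks of all large lengths at a vertex, then its bi-infinite
walks can be chosen continuously and equivariantly on the free part. -/
theorem exists_continuous_walk {V : Type} {E : V → V → Prop} {v : V} {N : ℕ} (hN : 0 < N)
    (h : ∀ m, N ≤ m → HasWalk E m v v) :
    ∃ F : freePart → V, (∀ s : Set V, IsOpen (F ⁻¹' s)) ∧ ∀ x, E (F x) (F (freeShift 1 x)) := by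
  classical
  -- One closed walk is fixed per length, so the filling of a gap depends only on its length; below
  -- `N` the value is irrelevant.
  have hw : ∀ m, ∃ w : ℕ → V, N ≤ m → w 0 = v ∧ w m = v ∧ ∀ i < m, E (w i) (w (i + 1)) := by
    intro m
    by_cases hm : N ≤ m
    · obtain ⟨w, hw⟩ := (h m hm).exists_path
      exact ⟨w, fun _ => hw⟩
    · exact ⟨fun _ => v, fun h => (hm h).elim⟩
  choose w hw using hw
  obtain ⟨M, hM, hgap, hsyn⟩ := exists_clopen_markers N hN
  have hback : ∀ x, ∃ d : ℕ, x ∈ freeShift (-d) ⁻¹' M := by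
    intro x
    obtain ⟨g, hg, hgM⟩ := hsyn (freeShift (-N) x)
    rw [freeShift_freeShift] at hgM
    rw [abs_lt] at hg
    refine ⟨(N - g).toNat, ?_⟩
    rwa [Set.mem_preimage, Int.toNat_of_nonneg (by omega), show -(N - g) = g + -N by ring]
  have hforth : ∀ x, ∃ e : ℕ, x ∈ freeShift (e + 1) ⁻¹' M := by
    intro x
    obtain ⟨g, hg, hgM⟩ := hsyn (freeShift N x)
    rw [freeShift_freeShift] at hgM
    rw [abs_lt] at hg
    refine ⟨(g + N - 1).toNat, ?_⟩
    rwa [Set.mem_preimage, Int.toNat_of_nonneg (by omega), sub_add_cancel]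
  -- The last marker, possibly `x` itself, is `d x` steps back, and the next one strictly ahead is
  -- at `e x + 1`. Hence the gap has length `d x + e x + 1` and `x` sits at position `d x` in it.
  let d : freePart → ℕ := fun x => Nat.find (hback x)
  let e : freePart → ℕ := fun x => Nat.find (hforth x)
  have hd : Continuous d := continuous_find (fun n => hM.preimage (continuous_freeShift _)) hback
  have he : Continuous e := continuous_find (fun n => hM.preimage (continuous_freeShift _)) hforth
  have hlen : ∀ x, N ≤ d x + e x + 1 := by
    intro x
    have h1 : freeShift (-d x) x ∈ M := Nat.find_spec (hback x)
    have h2 : freeShift (e x + 1) x ∈ M := Nat.find_spec (hforth x)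
    have := hgap _ h1 (d x + e x + 1) (by omega) (by
      rwa [freeShift_freeShift, show (d x + e x + 1 : ℤ) + -d x = e x + 1 by ring])
    omega
  refine ⟨fun x => w (d x + e x + 1) (d x), fun s => ?_, fun x => ?_⟩
  · exact (isOpen_discrete {p : ℕ × ℕ | w (p.1 + p.2 + 1) p.1 ∈ s}).preimage (hd.prodMk he)
  · obtain ⟨-, hend, hedge⟩ := hw _ (hlen x)
    -- At a marker the old walk ends and the new one begins, both at `v`. Elsewhere `d` increases
    -- and `e` decreases by one, so the same walk continues.
    by_cases hx : freeShift 1 x ∈ M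
    · have he0 : e x = 0 := (Nat.find_eq_zero _).2 (by simpa using hx)
      have hd0 : d (freeShift 1 x) = 0 := (Nat.find_eq_zero _).2 (by simpa [freeShift_zero] using hx)
      have hstart := (hw _ (hlen (freeShift 1 x))).1
      have := hedge (d x) (by omega)
      simp only [he0, add_zero] at this hend
      simp only [he0, add_zero]
      rw [hd0] at hstart ⊢
      rw [hstart]
      rwa [hend] at this
    · have hd1 : d (freeShift 1 x) = d x + 1 := by
        refine (Nat.find_eq_iff _).2 ⟨?_, fun n hn hmem => ?_⟩
        · have : freeShift (-d x) x ∈ M := Nat.find_spec (hback x)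
          rw [Set.mem_preimage, freeShift_freeShift]
          push_cast
          rwa [show -(d x + 1 : ℤ) + 1 = -d x by ring]
        · rw [Set.mem_preimage, freeShift_freeShift] at hmem
          cases n with
          | zero => exact hx (by simpa using hmem)
          | succ n =>
            push_cast at hmem
            rw [show -(n + 1 : ℤ) + 1 = -n by ring] at hmem
            exact Nat.find_min (hback x) (show n < d x by omega) hmem
      have he1 : e (freeShift 1 x) + 1 = e x := by
        refine ((Nat.find_eq_iff _).2 ⟨?_, fun n hn hmem => ?_⟩).symm
        · have : freeShift (e (freeShift 1 x) + 1) (freeShift 1 x) ∈ M :=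
            Nat.find_spec (hforth (freeShift 1 x))
          rw [freeShift_freeShift] at this
          rw [Set.mem_preimage]
          push_cast
          exact this
        · cases n with
          | zero => exact hx (by simpa using hmem)
          | succ n =>
            refine Nat.find_min (hforth (freeShift 1 x)) (show n < e (freeShift 1 x) by omega) ?_
            rw [Set.mem_preimage] at hmem ⊢
            rw [freeShift_freeShift]
            push_cast at hmem
            exact hmem
      have := hedge (d x) (by omega)
      beta_reduce
      rw [hd1, show d x + 1 + e (freeShift 1 x) + 1 = d x + e x + 1 by omega]
      exact this

/-- The image sequence reads the first letter of each vertex along the walk; the overlap condition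
makes its windows the vertices themselves. -/
theorem hasContinuousEquivariantMap_of_closed_walks {b L : ℕ} (hL : 0 < L)
    {P : (Fin L → Fin b) → Prop} {Y : Set (ℤ → Fin b)}
    (hY : ∀ x, (∀ c, P (window L x c)) → x ∈ Y) {v : {v // P v}} {n : ℕ} (hn : 0 < n)
    (h : HasWalk WordEdge n v v) (h' : HasWalk WordEdge (n + 1) v v) :
    HasContinuousEquivariantMap Y := by
  obtain ⟨F, hF, hE⟩ := exists_continuous_walk (Nat.mul_pos hn hn)
    fun m hm => hasWalk_of_mul_self_le hn h h' hm
  let f : freePart → ℤ → Fin b := fun x j => (F (freeShift j x)).1 ⟨0, hL⟩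
  have hwin : ∀ (x : freePart) (i : ℕ) (hi : i < L) (c : ℤ),
      f x (c + i) = (F (freeShift c x)).1 ⟨i, hi⟩ := by
    intro x i
    induction i with
    | zero => intro hi c; simp [f]
    | succ i ih =>
      intro hi c
      have h1 := hE (freeShift c x) i hi
      rw [freeShift_freeShift] at h1
      rw [← h1, add_comm 1 c, ← ih (by omega) (c + 1)]
      push_cast
      ring_nf
  have hfY : ∀ x, f x ∈ Y := fun x => hY _ fun c => by
    have : window L (f x) c = (F (freeShift c x)).1 := funext fun i => hwin x i i.2 c
    rw [this]
    exact (F _).2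
  refine ⟨fun x => ⟨f x, hfY x⟩, ?_, fun g x => ?_⟩
  · refine Continuous.subtype_mk (continuous_pi fun j => continuous_discrete_rng.2 fun a => ?_) _
    exact (hF {v | v.1 ⟨0, hL⟩ = a}).preimage (continuous_freeShift j)
  · funext j
    change (F (freeShift j (freeShift g x))).1 _ = (F (freeShift (j + g) x)).1 _
    rw [freeShift_freeShift]

/-- The predicate `P` is left abstract to serve both patterns of a common length and patterns of
mixed lengths at most `L`. -/
theorem hasContinuousEquivariantMap_iff {b L : ℕ} (hL : 0 < L)
    {P : (Fin L → Fin b) → Prop} {Y : Set (ℤ → Fin b)}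
    (hY : ∀ x, x ∈ Y ↔ ∀ c, P (window L x c)) :
    HasContinuousEquivariantMap Y ↔ ∃ (v : {v // P v}) (n : ℕ), 0 < n ∧
      HasWalk WordEdge n v v ∧ HasWalk WordEdge (n + 1) v v :=
  ⟨exists_closed_walks_of_map fun x hx => (hY x).1 hx, fun ⟨_, _, hn, h, h'⟩ =>
    hasContinuousEquivariantMap_of_closed_walks hL (fun x => (hY x).2) hn h h'⟩

theorem mem_sft_iff_window {b ℓ : ℕ} {ps : List (List (Fin b))} (h : ∀ p ∈ ps, p.length = ℓ)
    (x : ℤ → Fin b) : x ∈ sft b ps ↔ ∀ c, List.ofFn (window ℓ x c) ∉ ps := by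
  constructor
  · intro hx c hc
    refine hx _ hc ⟨c, fun i => ?_⟩
    simp [window]
  · rintro hx p hp ⟨c, hc⟩
    obtain rfl := h p hp
    refine hx c ?_
    have : window p.length x c = p.get := funext hc
    rwa [this, List.ofFn_get]

theorem hasContinuousEquivariantMap_sft_iff_component {b ℓ : ℕ} {ps : List (List (Fin b))}
    (hℓ : 1 ≤ ℓ) (h : ∀ p ∈ ps, p.length = ℓ) :
    HasContinuousEquivariantMap (sft b ps) ↔ ∃ C : Set (Window b ℓ ps),
      IsDirectedComponent WindowEdge C ∧
        Nat.setGcd (primitiveCycleLengths WindowEdge C) = 1 :=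
  (hasContinuousEquivariantMap_iff hℓ (mem_sft_iff_window h)).trans
    exists_consecutive_closed_walks_iff

end Characterization

/-! ### Closed walks as finite words, with a bound on their length. -/

section Words

/-- Walks in the overlap graph of the words of length `L` are long words. -/
theorem hasWalk_wordEdge_iff {A : Type} {L : ℕ} (hL : 0 < L) {P : (Fin L → A) → Prop} {n : ℕ}
    {u v : {v : Fin L → A // P v}} :
    HasWalk WordEdge n u v ↔ ∃ a : ℕ → A, (∀ i ≤ n, P fun k : Fin L => a (i + k)) ∧
      (∀ k : Fin L, a k = u.1 k) ∧ ∀ k : Fin L, a (n + k) = v.1 k := by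
  induction n generalizing u with
  | zero =>
    constructor
    · rintro rfl
      have h : ∀ k : Fin L, (fun k => if h : k < L then u.1 ⟨k, h⟩ else u.1 ⟨0, hL⟩) (k : ℕ) =
          u.1 k := fun k => by simp
      refine ⟨fun k => if h : k < L then u.1 ⟨k, h⟩ else u.1 ⟨0, hL⟩, fun i hi => ?_, h, ?_⟩
      · obtain rfl := Nat.le_zero.1 hi
        simpa using u.2
      · simp
    · rintro ⟨a, -, h, h'⟩
      exact Subtype.ext (funext fun k => by rw [← h, ← h', zero_add])
  | succ n ih =>
    constructor
    · rintro ⟨t, hut, h⟩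
      obtain ⟨a, ha, hat, hav⟩ := ih.1 h
      have hu : ∀ k : Fin L, (fun k => Nat.casesOn k (u.1 ⟨0, hL⟩) a : ℕ → A) k = u.1 k := by
        rintro ⟨k, hk⟩
        cases k with
        | zero => rfl
        | succ k => exact (hat ⟨k, by omega⟩).trans (hut k hk)
      refine ⟨fun k => Nat.casesOn k (u.1 ⟨0, hL⟩) a, fun i hi => ?_, hu, fun k => ?_⟩
      · cases i with
        | zero =>
          simp only [zero_add]
          simp only at hu
          simp only [hu]
          exact u.2
        | succ i =>
          simpa only [Nat.succ_add] using ha i (by omega)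
      · simpa only [Nat.succ_add] using hav k
    · rintro ⟨a, ha, hau, hav⟩
      refine ⟨⟨_, ha 1 (by omega)⟩, fun i hi => ?_, ih.2 ⟨fun k => a (k + 1), ?_, ?_, ?_⟩⟩
      · simpa only [add_comm 1] using hau ⟨i + 1, hi⟩
      · intro i hi
        simpa only [show ∀ k, i + k + 1 = i + 1 + k by omega] using ha (i + 1) (by omega)
      · intro k
        simp only [add_comm]
      · intro k
        simpa only [show n + k + 1 = n + 1 + k by omega] using hav k

/-- No pattern in `ps` occurs in the word `(a 0, …, a (m - 1))`. -/
def Avoids {A : Type} (ps : List (List A)) (a : ℕ → A) (m : ℕ) : Prop :=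
  ∀ p ∈ ps, ∀ c, c + p.length ≤ m → ¬ ∀ i : Fin p.length, a (c + i) = p.get i

theorem avoids_add_iff {A : Type} {ps : List (List A)} {L : ℕ} (hL : ∀ p ∈ ps, p.length ≤ L)
    (a : ℕ → A) (n : ℕ) :
    Avoids ps a (n + L) ↔ ∀ i ≤ n, Avoids ps (fun k => a (i + k)) L := by
  constructor
  · intro h i hi p hp c hc hocc
    refine h p hp (i + c) (by omega) fun k => ?_
    rw [add_assoc]
    exact hocc k
  · intro h p hp c hc hocc
    have hp' := hL p hp
    -- The window starting at the occurrence contains it, unless it would overrun the word; then the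
    -- last window, at `n`, does.
    refine h (min c n) (min_le_right _ _) p hp (c - min c n) (by omega) fun k => ?_
    beta_reduce
    rw [← hocc k, ← add_assoc, Nat.add_sub_cancel' (min_le_left c n)]

/-- A word of length `L > 0`, extended to a sequence by repeating its first letter. -/
def extendWord {A : Type} {L : ℕ} (hL : 0 < L) (v : Fin L → A) (k : ℕ) : A :=
  if h : k < L then v ⟨k, h⟩ else v ⟨0, hL⟩

theorem avoids_congr {A : Type} {ps : List (List A)} {a a' : ℕ → A} {m : ℕ}
    (h : ∀ k < m, a k = a' k) : Avoids ps a m ↔ Avoids ps a' m := by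
  refine forall₂_congr fun p _ => forall₂_congr fun c hc => not_congr <| forall_congr' fun i => ?_
  rw [h]
  have := i.2
  omega

theorem mem_sft_iff_avoids {b L : ℕ} (h0 : 0 < L) {ps : List (List (Fin b))}
    (hL : ∀ p ∈ ps, p.length ≤ L) (x : ℤ → Fin b) :
    x ∈ sft b ps ↔ ∀ c, Avoids ps (extendWord h0 (window L x c)) L := by
  constructor
  · intro hx c p hp d hd hocc
    refine hx p hp ⟨c + d, fun i => ?_⟩
    rw [← hocc i, extendWord, dif_pos (by omega), window]
    push_cast
    rw [add_assoc]
  · rintro hx p hp ⟨c, hc⟩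
    refine hx c p hp 0 (by simpa using hL p hp) fun i => ?_
    have := hL p hp
    rw [← hc i, extendWord, dif_pos (by omega), window]
    simp

/-- The bound on `n` comes from counting binary relations on at most `b ^ L` vertices, which makes
the search finite. -/
theorem hasContinuousEquivariantMap_sft_iff_words {b L : ℕ} (h0 : 0 < L)
    {ps : List (List (Fin b))} (hL : ∀ p ∈ ps, p.length ≤ L) :
    HasContinuousEquivariantMap (sft b ps) ↔
      ∃ n < 2 ^ (b ^ L * b ^ L) + 1, 0 < n ∧ ∃ a a' : ℕ → Fin b,
        (Avoids ps a (n + L) ∧ Avoids ps a' (n + 1 + L)) ∧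
          ∀ k < L, a (n + k) = a k ∧ a' k = a k ∧ a' (n + 1 + k) = a k := by
  have key : ∀ (a : ℕ → Fin b) (n : ℕ), Avoids ps a (n + L) ↔
      ∀ i ≤ n, Avoids ps (extendWord h0 fun k : Fin L => a (i + k)) L := by
    intro a n
    rw [avoids_add_iff hL]
    refine forall₂_congr fun i _ => avoids_congr fun k hk => ?_
    rw [extendWord, dif_pos hk]
  rw [hasContinuousEquivariantMap_iff h0 (P := fun v => Avoids ps (extendWord h0 v) L)
    (mem_sft_iff_avoids h0 hL)]
  constructor
  · rintro ⟨v, n, hn, h, h'⟩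
    obtain ⟨m, hm, hle, h, h'⟩ := exists_le_consecutive_closed_walks hn h h'
    obtain ⟨a, ha, hav, hav'⟩ := (hasWalk_wordEdge_iff h0).1 h
    obtain ⟨a', ha', hav₁, hav₁'⟩ := (hasWalk_wordEdge_iff h0).1 h'
    refine ⟨m, Nat.lt_succ_of_le (hle.trans ?_), hm, a, a', ⟨(key _ _).2 ha, (key _ _).2 ha'⟩,
      fun k hk => ?_⟩
    · have hcard : Nat.card {v : Fin L → Fin b // Avoids ps (extendWord h0 v) L} ≤ b ^ L := by
        refine (Finite.card_subtype_le _).trans ?_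
        simp
      rw [Nat.card_fun, Nat.card_fun, Nat.card_eq_fintype_card (α := Prop), Fintype.card_prop,
        ← pow_mul]
      exact Nat.pow_le_pow_right (by norm_num) (Nat.mul_le_mul hcard hcard)
    · rw [hav ⟨k, hk⟩, hav' ⟨k, hk⟩, hav₁ ⟨k, hk⟩, hav₁' ⟨k, hk⟩]
      exact ⟨rfl, rfl, rfl⟩
  · rintro ⟨n, -, hn, a, a', ⟨ha, ha'⟩, hk⟩
    rw [key] at ha ha'
    refine ⟨⟨fun k => a k, by simpa using ha 0 (Nat.zero_le _)⟩, n, hn,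
      (hasWalk_wordEdge_iff h0).2 ⟨a, ha, fun _ => rfl, fun k => (hk k k.2).1⟩,
      (hasWalk_wordEdge_iff h0).2 ⟨a', ha', fun k => (hk k k.2).2.1, fun k => (hk k k.2).2.2⟩⟩

end Words

/-! ### The decision procedure on codes. -/

section Computability

/-- The `i`-th digit of `s` in base `b`. -/
def digit (b s i : ℕ) : ℕ := s / b ^ i % b

theorem exists_digit_eq {b m : ℕ} (a : ℕ → Fin b) :
    ∃ s < b ^ m, ∀ i < m, digit b s i = a i := by
  let s : Fin (b ^ m) := finFunctionFinEquiv fun i => a i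
  refine ⟨s, s.2, fun i hi => ?_⟩
  have := congrFun (finFunctionFinEquiv.symm_apply_apply fun i : Fin m => a i) ⟨i, hi⟩
  exact congrArg Fin.val this

/-- The word of length `m` given by the digits of `s` in base `b` avoids the patterns `qs`. -/
def DigitsAvoid (b : ℕ) (qs : List (List ℕ)) (s m : ℕ) : Prop :=
  ∀ q ∈ qs, ∀ c < m + 1, c + q.length ≤ m → ¬ ∀ i < q.length, q[i]? = some (digit b s (c + i))

/-- The extra bound `c < m + 1` in `DigitsAvoid` follows from `c + q.length ≤ m`; it only makes the
quantifier visibly bounded. -/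
theorem digitsAvoid_iff {b : ℕ} {ps : List (List (Fin b))} {a : ℕ → Fin b} {s m : ℕ}
    (h : ∀ i < m, digit b s i = a i) :
    DigitsAvoid b (ps.map fun p => p.map Fin.val) s m ↔ Avoids ps a m := by
  rw [DigitsAvoid, List.forall_mem_map]
  refine forall₂_congr fun p _ => forall_congr' fun c => ?_
  rw [List.length_map]
  have : ∀ hc : c + p.length ≤ m,
      (∀ i < p.length, (p.map Fin.val)[i]? = some (digit b s (c + i))) ↔
        ∀ i : Fin p.length, a (c + i) = p.get i := by
    intro hc
    rw [Fin.forall_iff]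
    refine forall₂_congr fun i hi => ?_
    rw [h _ (by omega)]
    simp [hi, Fin.ext_iff, eq_comm]
  constructor
  · intro h1 hc
    rw [← this hc]
    exact h1 (by omega) hc
  · intro h1 _ hc
    rw [this hc]
    exact h1 hc

/-- Numbers `s` and `t` encode words that close up to walks of lengths `n` and `n + 1`. -/
def ClosedWalkCodes (b : ℕ) (qs : List (List ℕ)) (L n s t : ℕ) : Prop :=
  (DigitsAvoid b qs s (n + L) ∧ DigitsAvoid b qs t (n + 1 + L)) ∧
    ∀ k < L, digit b s (n + k) = digit b s k ∧ digit b t k = digit b s k ∧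
      digit b t (n + 1 + k) = digit b s k

/-- A word length that bounds the lengths of all patterns. -/
def windowLength (qs : List (List ℕ)) : ℕ := qs.flatten.length + 1

/-- The decision procedure for the subshift problem. -/
def SubshiftTest (d : ℕ × List (List ℕ)) : Prop :=
  (∀ q ∈ d.2, q ≠ [] ∧ ∀ a ∈ q, a < d.1) ∧
    ∃ n < 2 ^ (d.1 ^ windowLength d.2 * d.1 ^ windowLength d.2) + 1, 0 < n ∧
      ∃ s < d.1 ^ (n + windowLength d.2), ∃ t < d.1 ^ (n + 1 + windowLength d.2),
        ClosedWalkCodes d.1 d.2 (windowLength d.2) n s t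

theorem length_le_windowLength {qs : List (List ℕ)} {q : List ℕ} (h : q ∈ qs) :
    q.length ≤ windowLength qs :=
  (List.sublist_flatten_of_mem h).length_le.trans (Nat.le_succ _)

theorem exists_words_iff_exists_codes {b L n : ℕ} (h0 : 0 < L) {ps : List (List (Fin b))} :
    (∃ a a' : ℕ → Fin b, (Avoids ps a (n + L) ∧ Avoids ps a' (n + 1 + L)) ∧
        ∀ k < L, a (n + k) = a k ∧ a' k = a k ∧ a' (n + 1 + k) = a k) ↔
      ∃ s < b ^ (n + L), ∃ t < b ^ (n + 1 + L),
        ClosedWalkCodes b (ps.map fun p => p.map Fin.val) L n s t := by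
  have key : ∀ {a a' : ℕ → Fin b} {s t : ℕ}, (∀ i < n + L, digit b s i = a i) →
      (∀ i < n + 1 + L, digit b t i = a' i) →
      ((Avoids ps a (n + L) ∧ Avoids ps a' (n + 1 + L)) ∧
        (∀ k < L, a (n + k) = a k ∧ a' k = a k ∧ a' (n + 1 + k) = a k) ↔
      ClosedWalkCodes b (ps.map fun p => p.map Fin.val) L n s t) := by
    intro a a' s t hs ht
    rw [ClosedWalkCodes, digitsAvoid_iff hs, digitsAvoid_iff ht]
    refine and_congr_right fun _ => forall₂_congr fun k hk => ?_
    rw [hs _ (by omega), hs _ (by omega), ht _ (by omega), ht _ (by omega)]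
    simp only [Fin.ext_iff]
  constructor
  · rintro ⟨a, a', h⟩
    obtain ⟨s, hs, hsa⟩ := exists_digit_eq (m := n + L) a
    obtain ⟨t, ht, hta⟩ := exists_digit_eq (m := n + 1 + L) a'
    exact ⟨s, hs, t, ht, (key hsa hta).1 h⟩
  · rintro ⟨s, hs, t, ht, h⟩
    -- For `b = 0` there is no `s < 0 ^ (n + L)`, since `L > 0`.
    have hb : 0 < b := by
      by_contra hb
      obtain rfl : b = 0 := by omega
      rw [zero_pow (by omega)] at hs
      omega
    exact ⟨fun i => ⟨digit b s i, Nat.mod_lt _ hb⟩, fun i => ⟨digit b t i, Nat.mod_lt _ hb⟩,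
      (key (fun _ _ => rfl) fun _ _ => rfl).2 h⟩

theorem subshiftTest_iff (b : ℕ) (ps : List (List (Fin b))) :
    SubshiftTest (b, ps.map fun p => p.map Fin.val) ↔
      (∀ p ∈ ps, p ≠ []) ∧ HasContinuousEquivariantMap (sft b ps) := by
  -- The added `1` in `windowLength` matters when there are no patterns.
  have h0 : 0 < windowLength (ps.map fun p => p.map Fin.val) := Nat.succ_pos _
  have hL : ∀ p ∈ ps, p.length ≤ windowLength (ps.map fun p => p.map Fin.val) := by
    intro p hp
    rw [← List.length_map Fin.val]
    exact length_le_windowLength (List.mem_map_of_mem hp)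
  rw [SubshiftTest, hasContinuousEquivariantMap_sft_iff_words h0 hL]
  refine and_congr ?_ ?_
  · rw [List.forall_mem_map]
    refine forall₂_congr fun p _ => ?_
    simp
  · simp only [exists_words_iff_exists_codes h0]

theorem subshiftProblemSolvable_iff (m : ℕ) :
    SubshiftProblemSolvable m ↔ SubshiftTest (Denumerable.ofNat (ℕ × List (List ℕ)) m) := by
  constructor
  · rintro ⟨b, ps, hps, rfl, h⟩
    rw [code, Denumerable.ofNat_encode]
    exact (subshiftTest_iff b ps).2 ⟨hps, h⟩
  · intro h
    obtain ⟨⟨b, qs⟩, hd⟩ : ∃ d, d = Denumerable.ofNat (ℕ × List (List ℕ)) m := ⟨_, rfl⟩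
    rw [← hd] at h
    -- An arbitrary integer decodes to lists of naturals; the test's condition that all letters are
    -- below `b` lifts them to patterns over `Fin b`.
    have hqs : qs ∈ Set.range (List.map (List.map (Fin.val (n := b)))) := by
      rw [Set.range_list_map, Set.range_list_map]
      exact fun q hq a ha => ⟨⟨a, (h.1 q hq).2 a ha⟩, rfl⟩
    obtain ⟨ps, rfl⟩ := hqs
    obtain ⟨hps, h⟩ := (subshiftTest_iff b ps).1 h
    refine ⟨b, ps, hps, ?_, h⟩
    rw [← Denumerable.encode_ofNat (α := ℕ × List (List ℕ)) m, ← hd]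
    rfl

end Computability

/-! ### Primitive recursiveness of the decision procedure. -/

section PrimitiveRecursion

variable {α β : Type} [Primcodable α] [Primcodable β]

theorem primrecPred_exists_lt {f : α → ℕ} (hf : Primrec f) {p : α → ℕ → Prop}
    (hp : PrimrecPred fun x : α × ℕ => p x.1 x.2) : PrimrecPred fun a => ∃ x < f a, p a x := by
  have hR : PrimrecRel fun (x : ℕ) (a : α) => p a x := hp.comp (Primrec.snd.pair Primrec.fst)
  exact (hR.exists_mem_list.comp (Primrec.list_range.comp hf) Primrec.id).of_eq fun a => by simp

theorem primrecPred_forall_lt {f : α → ℕ} (hf : Primrec f) {p : α → ℕ → Prop}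
    (hp : PrimrecPred fun x : α × ℕ => p x.1 x.2) : PrimrecPred fun a => ∀ x < f a, p a x := by
  have hR : PrimrecRel fun (x : ℕ) (a : α) => p a x := hp.comp (Primrec.snd.pair Primrec.fst)
  exact (hR.forall_mem_list.comp (Primrec.list_range.comp hf) Primrec.id).of_eq fun a => by simp

theorem primrecPred_forall_mem {f : α → List β} (hf : Primrec f) {p : α → β → Prop}
    (hp : PrimrecPred fun x : α × β => p x.1 x.2) : PrimrecPred fun a => ∀ x ∈ f a, p a x := by
  have hR : PrimrecRel fun (x : β) (a : α) => p a x := hp.comp (Primrec.snd.pair Primrec.fst)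
  exact hR.forall_mem_list.comp hf Primrec.id

theorem primrec_pow : Primrec₂ ((· ^ ·) : ℕ → ℕ → ℕ) :=
  Primrec₂.unpaired'.1 Nat.Primrec.pow

theorem primrec_digit {f g h : α → ℕ} (hf : Primrec f) (hg : Primrec g) (hh : Primrec h) :
    Primrec fun x => digit (f x) (g x) (h x) :=
  Primrec.nat_mod.comp (Primrec.nat_div.comp hg (primrec_pow.comp hf hh)) hf

theorem primrecPred_digitsAvoid {f s m : α → ℕ} {g : α → List (List ℕ)} (hf : Primrec f)
    (hg : Primrec g) (hs : Primrec s) (hm : Primrec m) :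
    PrimrecPred fun x => DigitsAvoid (f x) (g x) (s x) (m x) := by
  have h1 : PrimrecPred fun y : ((α × List ℕ) × ℕ) => ∀ i < y.1.2.length,
      y.1.2[i]? = some (digit (f y.1.1) (s y.1.1) (y.2 + i)) := by
    refine primrecPred_forall_lt (Primrec.list_length.comp (Primrec.snd.comp Primrec.fst)) ?_
    have hx : Primrec fun y : ((α × List ℕ) × ℕ) × ℕ => y.1.1.1 :=
      Primrec.fst.comp (Primrec.fst.comp Primrec.fst)
    exact Primrec.eq.comp
      (Primrec.list_getElem?.comp (Primrec.snd.comp (Primrec.fst.comp Primrec.fst)) Primrec.snd)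
      (Primrec.option_some.comp (primrec_digit (hf.comp hx) (hs.comp hx)
        (Primrec.nat_add.comp (Primrec.snd.comp Primrec.fst) Primrec.snd)))
  have h2 : PrimrecPred fun y : ((α × List ℕ) × ℕ) => y.2 + y.1.2.length ≤ m y.1.1 :=
    Primrec.nat_le.comp (Primrec.nat_add.comp Primrec.snd
      (Primrec.list_length.comp (Primrec.snd.comp Primrec.fst)))
      (hm.comp (Primrec.fst.comp Primrec.fst))
  have h3 := h2.not.or h1.not
  refine primrecPred_forall_mem hg (primrecPred_forall_lt (Primrec.succ.comp
    (hm.comp Primrec.fst)) (h3.of_eq fun y => ?_))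
  exact imp_iff_not_or.symm

theorem primrecPred_closedWalkCodes {f l n s t : α → ℕ} {g : α → List (List ℕ)} (hf : Primrec f)
    (hg : Primrec g) (hl : Primrec l) (hn : Primrec n) (hs : Primrec s) (ht : Primrec t) :
    PrimrecPred fun x => ClosedWalkCodes (f x) (g x) (l x) (n x) (s x) (t x) := by
  refine ((primrecPred_digitsAvoid hf hg hs (Primrec.nat_add.comp hn hl)).and
    (primrecPred_digitsAvoid hf hg ht (Primrec.nat_add.comp (Primrec.succ.comp hn) hl))).and
      (primrecPred_forall_lt hl ?_)
  have hf' : Primrec fun x : α × ℕ => f x.1 := hf.comp Primrec.fst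
  have hn' : Primrec fun x : α × ℕ => n x.1 := hn.comp Primrec.fst
  have hs' : Primrec fun x : α × ℕ => s x.1 := hs.comp Primrec.fst
  have ht' : Primrec fun x : α × ℕ => t x.1 := ht.comp Primrec.fst
  have h0 := primrec_digit hf' hs' Primrec.snd
  exact (Primrec.eq.comp (primrec_digit hf' hs' (Primrec.nat_add.comp hn' Primrec.snd)) h0).and
    ((Primrec.eq.comp (primrec_digit hf' ht' Primrec.snd) h0).and
      (Primrec.eq.comp (primrec_digit hf' ht'
        (Primrec.nat_add.comp (Primrec.succ.comp hn') Primrec.snd)) h0))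

theorem primrec_windowLength : Primrec windowLength :=
  Primrec.succ.comp (Primrec.list_length.comp Primrec.list_flatten)

theorem primrecPred_subshiftTest : PrimrecPred SubshiftTest := by
  have hL : Primrec fun d : ℕ × List (List ℕ) => windowLength d.2 :=
    primrec_windowLength.comp Primrec.snd
  have hpow : Primrec fun d : ℕ × List (List ℕ) => d.1 ^ windowLength d.2 :=
    primrec_pow.comp Primrec.fst hL
  refine PrimrecPred.and (primrecPred_forall_mem Primrec.snd (PrimrecPred.and
    (Primrec.eq.comp Primrec.snd (Primrec.const [])).not
    (primrecPred_forall_mem Primrec.snd (Primrec.nat_lt.comp Primrec.snd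
      (Primrec.fst.comp (Primrec.fst.comp Primrec.fst))))))
    (primrecPred_exists_lt (Primrec.succ.comp (primrec_pow.comp (Primrec.const 2)
      (Primrec.nat_mul.comp hpow hpow))) (PrimrecPred.and
        (Primrec.nat_lt.comp (Primrec.const 0) Primrec.snd)
        (primrecPred_exists_lt (primrec_pow.comp (Primrec.fst.comp Primrec.fst)
          (Primrec.nat_add.comp Primrec.snd (hL.comp Primrec.fst)))
          (primrecPred_exists_lt (primrec_pow.comp
            (Primrec.fst.comp (Primrec.fst.comp Primrec.fst))
            (Primrec.nat_add.comp (Primrec.succ.comp (Primrec.snd.comp Primrec.fst))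
              (hL.comp (Primrec.fst.comp Primrec.fst)))) ?_))))
  have hd : Primrec fun x : ((((ℕ × List (List ℕ)) × ℕ) × ℕ) × ℕ) => x.1.1.1 :=
    Primrec.fst.comp (Primrec.fst.comp Primrec.fst)
  exact primrecPred_closedWalkCodes (Primrec.fst.comp hd) (Primrec.snd.comp hd) (hL.comp hd)
    (Primrec.snd.comp (Primrec.fst.comp Primrec.fst)) (Primrec.snd.comp Primrec.fst) Primrec.snd

theorem computablePred_subshiftProblemSolvable : ComputablePred SubshiftProblemSolvable :=
  ((primrecPred_subshiftTest.comp (Primrec.ofNat _)).of_eq fun m =>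
    (subshiftProblemSolvable_iff m).symm).computablePred

end PrimitiveRecursion

end SubshiftProblem

theorem mainTheorem7 :
    ComputablePred SubshiftProblem.SubshiftProblemSolvable ∧
      ∀ (b ℓ : ℕ) (ps : List (List (Fin b))), 1 ≤ ℓ → (∀ p ∈ ps, p.length = ℓ) →
        (SubshiftProblem.HasContinuousEquivariantMap (SubshiftProblem.sft b ps) ↔
          ∃ C : Set (SubshiftProblem.Window b ℓ ps),
            SubshiftProblem.IsDirectedComponent SubshiftProblem.WindowEdge C ∧
              Nat.setGcd (SubshiftProblem.primitiveCycleLengths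
                SubshiftProblem.WindowEdge C) = 1) := by
  exact ⟨SubshiftProblem.computablePred_subshiftProblemSolvable, fun _ _ _ hℓ h =>
    SubshiftProblem.hasContinuousEquivariantMap_sft_iff_component hℓ h⟩
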